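/- For nonnegative integers $l,r,l',r'$, a discrete differential operator with stencil $(l,r,l',r')$ is a family of real coefficients $(\alpha_k)_{-l\le k\le r-1}$, $(\beta_k)_{-l'\le k\le r'}$. For a function $u:\mathbb{R}\to\mathbb{R}$, a grid size $h>0$ and a node $x\in\mathbb{R}$ put $$[\mathcal{D}_xu](x)=\frac1h\sum_{k=-l}^{r-1}\alpha_k\,\frac1h\int_{x+kh}^{x+(k+1)h}u(y)\,dy+\frac1h\sum_{k=-l'}^{r'}\beta_k\,u(x+kh).$$ The operator is accurate of order $p$ if there is a constant $c\ne0$ such that for every smooth $u$ and every $x$, as $h\to0^+$, $[\mathcal{D}_xu](x)=u'(x)+c\,u^{(p+1)}(x)\,h^p+O(h^{p+1})$. It is optimal if it is accurate of order $p=l+r+l'+r'$. Let $H(\theta)=\sum_{k=-l'}^{r'}\beta_k e^{ik\theta}$. Theorem 3. Fix a nonnegative integer $m$, and for each nonnegative integer $t$ consider the stencil $(l,r,l',r')=(t+m,t,t+m,t)$. If $m\equiv1\pmod 4$, then for all sufficiently large $t$ there is a unique optimal discrete differential operator with this stencil, and $\operatorname{Re}H(\pi)>0$ for it. If $m\equiv3\pmod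 4$, then for all sufficiently large $t$ there is a unique optimal discrete differential operator with this stencil, and $\operatorname{Re}H(\pi)<0$ for it. -/

import Mathlib

open Filter Topology Asymptotics
open scoped ContDiff

/-- A discrete differential operator with stencil `(l, r, l', r')`: real coefficients `α k` of the
cell averages, `-l ≤ k ≤ r - 1`, and `β k` of the nodal values, `-l' ≤ k ≤ r'`, independent of the
grid size. The families are indexed by `ℤ` and vanish off the stencil, so that two operators are
equal exactly when their coefficients on the stencil are. -/
@[ext]
structure DDO (l r l' r' : ℕ) where
  α : ℤ → ℝ
  β : ℤ → ℝ
  α_eq_zero : ∀ k, k ∉ Finset.Ico (-(l : ℤ)) (r : ℤ) → α k = 0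
  β_eq_zero : ∀ k, k ∉ Finset.Icc (-(l' : ℤ)) (r' : ℤ) → β k = 0

/-- The average of `u` over the cell `[x, x + h]`. -/
noncomputable def cellAverage (u : ℝ → ℝ) (h x : ℝ) : ℝ :=
  1 / h * ∫ y in x..(x + h), u y

namespace DDO

variable {l r l' r' : ℕ}

/-- The value at the node `x` of the operator applied to the exact cell averages and nodal values
of `u` on the uniform grid of size `h` through `x`. -/
noncomputable def apply (D : DDO l r l' r') (h : ℝ) (u : ℝ → ℝ) (x : ℝ) : ℝ :=
  1 / h * ∑ k ∈ Finset.Ico (-(l : ℤ)) (r : ℤ), D.α k * cellAverage u h (x + k * h)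
    + 1 / h * ∑ k ∈ Finset.Icc (-(l' : ℤ)) (r' : ℤ), D.β k * u (x + k * h)

/-- The operator is accurate of order `p`: for some `c ≠ 0` and every smooth `u`, the operator
equals `u_x + c u^(p+1) h^p + O(h^(p+1))` as `h → 0+`. -/
def IsAccurateOfOrder (D : DDO l r l' r') (p : ℕ) : Prop :=
  ∃ c : ℝ, c ≠ 0 ∧ ∀ u : ℝ → ℝ, ContDiff ℝ ∞ u → ∀ x : ℝ,
    (fun h : ℝ => D.apply h u x - (deriv u x + c * iteratedDeriv (p + 1) u x * h ^ p))
      =O[𝓝[>] (0 : ℝ)] fun h : ℝ => h ^ (p + 1)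

/-- The operator has the optimal order of accuracy `l + r + l' + r'`. -/
def IsOptimal (D : DDO l r l' r') : Prop :=
  D.IsAccurateOfOrder (l + r + l' + r')

/-- The symbol `H(θ) = ∑ β_k e^{ikθ}` of the nodal part of the operator. -/
noncomputable def H (D : DDO l r l' r') (θ : ℝ) : ℂ :=
  ∑ k ∈ Finset.Icc (-(l' : ℤ)) (r' : ℤ), (D.β k : ℂ) * Complex.exp (Complex.I * k * θ)

end DDO

/-! By scaling, the operator is `1 / h` times a fixed functional on the unit grid, and Taylor
expansion turns accuracy of order `p` into conditions on moments: those of degree at most `p` agree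
with the derivative at `0`, and the next one is nonzero. Applied to `U'` for a polynomial `U`, the
functional sees only differences of `U` and values of `U'` at the nodes, which are Hermite data.
When `l = l'` and `r = r'`, Hermite interpolation at the `l + r + 1` nodes therefore yields a unique
optimal operator, with `β j = U_j''(0)` for `U_j = (X - j) L_j ^ 2` and `L_j` the Lagrange basis
(`functional_hermiteSlope`, `existsUnique_isOptimal`).

Write `C_j` for the binomial coefficient `C(l + r, l + j)`. Evaluating `L_j'(0)` gives `β j = -2
C_j² / (C_0² j)` for `j ≠ 0` and `β 0 = 4 ∑ (-1)^j C_j / (C_0 j)` over `j ≠ 0`. Hence `Re H(π)` is a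
positive multiple of `∑ (-1)^j (2 C_0 C_j - C_j²) / j` (`IsOptimal.H_pi_re_mul`).

This sum comes from Fourier orthogonality for the trigonometric polynomial with coefficients `(-1)^j
C_j`, which by the binomial theorem is a unimodular constant times `(2 sin (x/2))^n e^{imx/2}`,
where `n = l + r` and `m = l - r`. For odd `m`, a reflection reduces the resulting double integral
to that of `(4 sin (x/2) sin (y/2))^n sin (m (x + y) / 2)` over the triangle `x, y ≥ 0`, `x + y ≤ π`
(`sum_shiftedChoose_eq_integral`). The base is largest only at `x = y = π/2`, where the last factor
is `sin (m π / 2) = ±1`; for large `n` this decides the sign (`eventually_integral_triangle_pos`).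
-/

namespace DDO

/-! ### The functional on the unit grid. -/

variable {l r l' r' : ℕ}

/-- The linear functional that an operator induces on functions on the unit grid. -/
noncomputable def functional (D : DDO l r l' r') (g : ℝ → ℝ) : ℝ :=
  ∑ k ∈ Finset.Ico (-(l : ℤ)) (r : ℤ), D.α k * (∫ s in (k : ℝ)..(k + 1), g s)
    + ∑ k ∈ Finset.Icc (-(l' : ℤ)) (r' : ℤ), D.β k * g k

/-- The value of `functional` at a monomial. -/
noncomputable def moment (D : DDO l r l' r') (d : ℕ) : ℝ :=
  D.functional fun s => s ^ d

theorem apply_eq_functional (D : DDO l r l' r') {h : ℝ} (hh : h ≠ 0) (u : ℝ → ℝ) (x : ℝ) :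
    D.apply h u x = 1 / h * D.functional fun s => u (x + s * h) := by
  unfold apply functional cellAverage
  rw [mul_add]
  congr 2
  refine Finset.sum_congr rfl fun k _ => ?_
  congr 1
  have := intervalIntegral.integral_comp_add_mul (a := (k : ℝ)) (b := k + 1) u hh x
  simp only [mul_comm h] at this
  rw [this, smul_eq_mul, one_div]
  congr 2
  ring

theorem functional_add (D : DDO l r l' r') {f g : ℝ → ℝ} (hf : Continuous f) (hg : Continuous g) :
    (D.functional fun s => f s + g s) = D.functional f + D.functional g := by
  unfold functional
  simp_rw [intervalIntegral.integral_add (hf.intervalIntegrable _ _) (hg.intervalIntegrable _ _),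
    mul_add, Finset.sum_add_distrib]
  ring

theorem functional_const_mul (D : DDO l r l' r') (c : ℝ) (f : ℝ → ℝ) :
    (D.functional fun s => c * f s) = c * D.functional f := by
  unfold functional
  simp_rw [intervalIntegral.integral_const_mul, mul_add, Finset.mul_sum, mul_left_comm c]

theorem functional_sum (D : DDO l r l' r') {ι : Type*} (t : Finset ι) {f : ι → ℝ → ℝ}
    (hf : ∀ i, Continuous (f i)) :
    (D.functional fun s => ∑ i ∈ t, f i s) = ∑ i ∈ t, D.functional (f i) := by
  classical
  induction t using Finset.induction_on with
  | empty => simp [functional]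
  | insert a t ha ih =>
    simp_rw [Finset.sum_insert ha]
    rw [functional_add D (hf a) (continuous_finsetSum _ fun i _ => hf i), ih]

theorem functional_eval (D : DDO l r l' r') {P : Polynomial ℝ} {N : ℕ} (hP : P.natDegree < N) :
    (D.functional fun s => P.eval s) = ∑ d ∈ Finset.range N, P.coeff d * D.moment d := by
  simp_rw [Polynomial.eval_eq_sum_range' hP]
  rw [functional_sum D _ fun i => by fun_prop]
  exact Finset.sum_congr rfl fun d _ => functional_const_mul D _ _

/-- By the fundamental theorem of calculus only the values of `U` and `U'` at the nodes enter; this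
is the link with Hermite interpolation. -/
theorem functional_eval_derivative (D : DDO l r l' r') (U : Polynomial ℝ) :
    (D.functional fun s => U.derivative.eval s) =
      ∑ k ∈ Finset.Ico (-(l : ℤ)) (r : ℤ), D.α k * (U.eval (k + 1 : ℝ) - U.eval (k : ℝ))
        + ∑ k ∈ Finset.Icc (-(l' : ℤ)) (r' : ℤ), D.β k * U.derivative.eval (k : ℝ) := by
  unfold functional
  congr 1
  refine Finset.sum_congr rfl fun k _ => ?_
  rw [intervalIntegral.integral_eq_sub_of_hasDerivAt (fun x _ => U.hasDerivAt x)
    (U.derivative.continuous.intervalIntegrable _ _)]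

/-- The functional is bounded by the supremum over a window that contains the stencil. -/
theorem exists_functional_bound (D : DDO l r l' r') : ∃ A W : ℝ, 0 ≤ A ∧ 0 ≤ W ∧
    ∀ (g : ℝ → ℝ) (C : ℝ), (∀ s, |s| ≤ A → |g s| ≤ C) → |D.functional g| ≤ W * C := by
  -- The window is generous: any radius covering all cells and nodes serves. The factor is the sum
  -- of the absolute coefficients, since cells have length 1.
  refine ⟨l + r + l' + r', ∑ k ∈ Finset.Ico (-(l : ℤ)) (r : ℤ), |D.α k| +
    ∑ k ∈ Finset.Icc (-(l' : ℤ)) (r' : ℤ), |D.β k|, by positivity, by positivity, ?_⟩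
  intro g C hg
  unfold functional
  rw [add_mul, Finset.sum_mul, Finset.sum_mul]
  refine (abs_add_le _ _).trans (add_le_add ?_ ?_)
  · refine (Finset.abs_sum_le_sum_abs _ _).trans (Finset.sum_le_sum fun k hk => ?_)
    rw [abs_mul]
    refine mul_le_mul_of_nonneg_left ?_ (abs_nonneg _)
    rw [Finset.mem_Ico] at hk
    have h1 : -(l : ℝ) ≤ k := by exact_mod_cast hk.1
    have h2 : (k : ℝ) + 1 ≤ r := by exact_mod_cast hk.2
    have := intervalIntegral.norm_integral_le_of_norm_le_const (a := (k : ℝ)) (b := k + 1)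
      (f := g) (C := C) fun s hs => by
        rw [Set.uIoc_of_le (by linarith)] at hs
        refine hg s ?_
        have := hs.1
        have := hs.2
        have : (0 : ℝ) ≤ l := by positivity
        have : (0 : ℝ) ≤ r := by positivity
        have : (0 : ℝ) ≤ l' := by positivity
        have : (0 : ℝ) ≤ r' := by positivity
        rw [abs_le]
        constructor <;> linarith
    simpa using this
  · refine (Finset.abs_sum_le_sum_abs _ _).trans (Finset.sum_le_sum fun k hk => ?_)
    rw [abs_mul]
    refine mul_le_mul_of_nonneg_left (hg _ ?_) (abs_nonneg _)
    rw [Finset.mem_Icc] at hk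
    have h1 : -(l' : ℝ) ≤ k := by exact_mod_cast hk.1
    have h2 : (k : ℝ) ≤ r' := by exact_mod_cast hk.2
    have : (0 : ℝ) ≤ l := by positivity
    have : (0 : ℝ) ≤ r := by positivity
    have : (0 : ℝ) ≤ l' := by positivity
    have : (0 : ℝ) ≤ r' := by positivity
    rw [abs_le]
    constructor <;> linarith

end DDO

/-! ### Accuracy in terms of moments. -/

theorem eq_zero_of_mul_pow_isBigO {K : ℝ} {a b : ℕ} (hab : a < b)
    (h : (fun x : ℝ => K * x ^ a) =O[𝓝[>] (0 : ℝ)] fun x : ℝ => x ^ b) : K = 0 := by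
  by_contra hK
  have h1 : (fun x : ℝ => x ^ b) =o[𝓝[>] (0 : ℝ)] fun x : ℝ => x ^ a :=
    (isLittleO_pow_pow hab).mono nhdsWithin_le_nhds
  have h2 := (isLittleO_const_mul_left_iff hK).1 (h.trans_isLittleO h1)
  have h3 : (fun x : ℝ => x ^ a) =ᶠ[𝓝[>] (0 : ℝ)] fun _ => (0 : ℝ) := by
    filter_upwards [h2.bound (c := 1 / 2) (by norm_num)] with x hx
    have : ‖x ^ a‖ = 0 := by
      have := norm_nonneg (x ^ a)
      linarith
    simpa using this
  obtain ⟨x, hx, hx0⟩ := (h3.and self_mem_nhdsWithin).exists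
  exact (pow_pos (Set.mem_Ioi.1 hx0) a).ne' hx

/-- The remainder past degree `N` is `o(s ^ N)` by Peano's form, and the term of degree `N` is
itself `O(s ^ N)`. -/
theorem taylor_remainder_isBigO {u : ℝ → ℝ} (hu : ContDiff ℝ ∞ u) (x : ℝ) (N : ℕ) :
    ∃ C δ : ℝ, 0 < δ ∧ 0 ≤ C ∧ ∀ s, |s| ≤ δ →
      |u (x + s) - ∑ d ∈ Finset.range N, iteratedDeriv d u x / d.factorial * s ^ d|
        ≤ C * |s| ^ N := by
  have h1 := taylor_isLittleO_univ (f := u) (x₀ := x) (n := N)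
    (hu.of_le (by exact_mod_cast le_top))
  have h2 : Tendsto (fun s : ℝ => x + s) (𝓝 0) (𝓝 x) := by
    have : Continuous fun s : ℝ => x + s := by fun_prop
    simpa using this.tendsto 0
  have h3 := h1.comp_tendsto h2
  have h4 : (fun s : ℝ => u (x + s) -
      ∑ d ∈ Finset.range N, iteratedDeriv d u x / d.factorial * s ^ d) =O[𝓝 0]
        fun s : ℝ => s ^ N := by
    have h5 : (fun s : ℝ => iteratedDeriv N u x / N.factorial * s ^ N) =O[𝓝 0]
        fun s : ℝ => s ^ N := isBigO_const_mul_self _ _ _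
    have h6 := (h3.isBigO.congr_right (g₂ := fun s : ℝ => s ^ N)
      fun s => by simp).add h5
    refine h6.congr_left fun s => ?_
    simp only [Function.comp, taylor_within_apply, Finset.sum_range_succ, smul_eq_mul,
      iteratedDerivWithin_univ, add_sub_cancel_left]
    have : ∀ d : ℕ, ((d.factorial : ℝ)⁻¹ * s ^ d) * iteratedDeriv d u x =
      iteratedDeriv d u x / d.factorial * s ^ d := fun d => by ring
    simp_rw [this]
    ring
  obtain ⟨C, hC, h5⟩ := h4.exists_nonneg
  obtain ⟨δ, hδ, h6⟩ := Metric.eventually_nhds_iff.1 h5.bound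
  refine ⟨C, δ / 2, by positivity, hC, fun s hs => ?_⟩
  have := @h6 s (by rw [Real.dist_eq, sub_zero]; linarith)
  simpa [abs_pow] using this

namespace DDO

variable {l r l' r' : ℕ}

/-- Test on `y ^ d` at `x = 0`: the error term with `u^(p+1)` vanishes, and homogeneity leaves a
multiple of `e ^ d` that is `O(e ^ (p + 2))` after multiplication by `e`. -/
theorem IsAccurateOfOrder.moment_eq {D : DDO l r l' r'} {p : ℕ}
    (hD : D.IsAccurateOfOrder p) {d : ℕ} (hd : d ≤ p) :
    D.moment d = if d = 1 then 1 else 0 := by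
  obtain ⟨c, -, h⟩ := hD
  have h1 := h (fun y => y ^ d) (by fun_prop) 0
  have h0 : iteratedDeriv (p + 1) (fun y : ℝ => y ^ d) 0 = 0 := by
    rw [iteratedDeriv_fun_pow_zero, if_neg (by omega), Nat.cast_zero]
  have hder : deriv (fun y : ℝ => y ^ d) 0 = if d = 1 then 1 else 0 := by
    rw [← iteratedDeriv_one, iteratedDeriv_fun_pow_zero]
    rcases eq_or_ne d 1 with rfl | hd1 <;> simp [*]
    exact fun h => absurd h.symm hd1
  have h2 : (fun e : ℝ => (D.moment d - if d = 1 then 1 else 0) * e ^ d) =O[𝓝[>] (0 : ℝ)]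
      fun e : ℝ => e ^ (p + 2) := by
    have h3 := (isBigO_refl (fun e : ℝ => e) (𝓝[>] (0 : ℝ))).mul h1
    refine h3.congr' ?_ (Eventually.of_forall fun e => by ring)
    filter_upwards [self_mem_nhdsWithin] with e he
    have he : e ≠ 0 := (Set.mem_Ioi.1 he).ne'
    rw [apply_eq_functional D he, h0, hder]
    simp_rw [zero_add, mul_pow, mul_comm _ (e ^ d)]
    rw [functional_const_mul]
    change e * (1 / e * (e ^ d * D.moment d) - _) = _
    split_ifs with hd1
    · subst hd1
      field_simp
      ring
    · field_simp
      ring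
  have h4 := eq_zero_of_mul_pow_isBigO (by omega) h2
  linarith

/-- Expand `u` to degree `p + 1`. The moments kill all terms but those of degree `1` and `p + 1`;
the latter gives the error constant, and the remainder is controlled on the bounded window of the
functional. -/
theorem isAccurateOfOrder_of_moment {D : DDO l r l' r'} {p : ℕ} (hp : 1 ≤ p)
    (h : ∀ d ≤ p, D.moment d = if d = 1 then 1 else 0) (h' : D.moment (p + 1) ≠ 0) :
    D.IsAccurateOfOrder p := by
  refine ⟨D.moment (p + 1) / (p + 1).factorial, by positivity, fun u hu x => ?_⟩
  obtain ⟨A, W, hA, hW, hb⟩ := D.exists_functional_bound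
  obtain ⟨C, δ, hδ, hC, ht⟩ := taylor_remainder_isBigO hu x (p + 2)
  refine IsBigO.of_bound (W * (C * A ^ (p + 2))) ?_
  have hev : ∀ᶠ h : ℝ in 𝓝[>] (0 : ℝ), A * h ≤ δ := by
    have : Continuous fun h : ℝ => A * h := by fun_prop
    have h2 : Tendsto (fun h : ℝ => A * h) (𝓝[>] 0) (𝓝 (A * 0)) :=
      (this.tendsto 0).mono_left nhdsWithin_le_nhds
    rw [mul_zero] at h2
    exact (h2.eventually (gt_mem_nhds hδ)).mono fun _ => le_of_lt
  filter_upwards [hev, self_mem_nhdsWithin] with e he he0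
  have he0 : 0 < e := he0
  set R : ℝ → ℝ := fun s => u (x + s * e) -
    ∑ d ∈ Finset.range (p + 2), iteratedDeriv d u x / d.factorial * (s * e) ^ d with hR
  have hRc : Continuous R := by
    have := hu.continuous
    fun_prop
  have h1 : |D.functional R| ≤ W * (C * (A * e) ^ (p + 2)) := by
    refine hb _ _ fun s hs => ?_
    have h2 : |s * e| ≤ A * e := by
      rw [abs_mul, abs_of_pos he0]
      gcongr
    refine (ht _ (h2.trans he)).trans ?_
    gcongr
  have h2 : (D.functional fun s => u (x + s * e)) = D.functional R +
      (e * deriv u x + D.moment (p + 1) / (p + 1).factorial * iteratedDeriv (p + 1) u x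
        * e ^ (p + 1)) := by
    have h3 : (fun s => u (x + s * e)) = fun s => R s +
        ∑ d ∈ Finset.range (p + 2), (iteratedDeriv d u x / d.factorial * e ^ d) * s ^ d := by
      funext s
      simp only [hR, mul_pow]
      rw [eq_comm, sub_add_eq_add_sub, sub_eq_iff_eq_add]
      congr 1
      exact Finset.sum_congr rfl fun d _ => by ring
    rw [h3, functional_add D hRc (by fun_prop), functional_sum D _ fun i => by fun_prop]
    congr 1
    simp_rw [functional_const_mul]
    rw [Finset.sum_range_succ]
    congr 1
    · rw [Finset.sum_eq_single 1]
      · change _ * D.moment 1 = _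
        rw [h 1 hp]
        simp
        ring
      · intro d hd hd1
        change _ * D.moment d = _
        rw [h d (by simpa [Nat.lt_succ_iff] using hd), if_neg hd1, mul_zero]
      · intro h
        simp at h
        omega
    · change _ * D.moment (p + 1) = _
      ring
  rw [apply_eq_functional D he0.ne', h2, Real.norm_eq_abs, Real.norm_eq_abs]
  have h4 : 1 / e * (D.functional R + (e * deriv u x + D.moment (p + 1) / (p + 1).factorial *
      iteratedDeriv (p + 1) u x * e ^ (p + 1))) - (deriv u x + D.moment (p + 1) /
      (p + 1).factorial * iteratedDeriv (p + 1) u x * e ^ p) = D.functional R / e := by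
    field_simp
    ring
  rw [h4, abs_div, abs_of_pos he0, abs_of_pos (pow_pos he0 _), div_le_iff₀ he0]
  refine h1.trans (le_of_eq ?_)
  ring

end DDO

/-! ### Fourier integrals over a period. -/

open Complex in
theorem integral_exp_neg_int_mul {k : ℤ} (hk : k ≠ 0) (a b : ℝ) :
    ∫ x in a..b, exp (-(k * I) * (x : ℂ)) =
      (exp (-(k * I) * (a : ℂ)) - exp (-(k * I) * (b : ℂ))) / (k * I) := by
  have h : -((k : ℂ) * I) ≠ 0 := by simp [hk]
  have h' : (k : ℂ) * I ≠ 0 := by simp [hk]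
  rw [integral_exp_mul_complex h]
  field_simp
  ring

open Complex in
theorem exp_neg_int_mul_two_pi (k : ℤ) : exp (-(k * I) * ((2 * Real.pi : ℝ) : ℂ)) = 1 := by
  rw [← Complex.exp_int_mul_two_pi_mul_I (-k)]
  congr 1
  push_cast
  ring

open Complex in
theorem exp_neg_int_mul_pi_sub (k : ℤ) (x : ℝ) : exp (-(k * I) * ((Real.pi - x : ℝ) : ℂ)) =
    (-1) ^ k * exp (k * I * x) := by
  have := Complex.exp_periodic.sub_zsmul_eq (x := k * (Real.pi * I) + k * I * x) k
  rw [← Complex.exp_pi_mul_I, ← Complex.exp_int_mul, ← Complex.exp_add, ← this]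
  congr 1
  push_cast
  simp
  ring

open Complex in
theorem integral_exp_neg_int_mul_period (k : ℤ) :
    ∫ x in (0 : ℝ)..(2 * Real.pi), exp (-(k * I) * (x : ℂ)) = if k = 0 then 2 * (Real.pi : ℂ) else 0 := by
  split_ifs with h
  · simp [h]
  · rw [integral_exp_neg_int_mul h, exp_neg_int_mul_two_pi]
    simp

open Complex in
theorem integral_pi_sub_mul_exp_period (k : ℤ) :
    ∫ x in (0 : ℝ)..(2 * Real.pi), ((Real.pi - x : ℝ) : ℂ) * exp (-(k * I) * (x : ℂ)) =
      if k = 0 then 0 else 2 * (Real.pi : ℂ) / (k * I) := by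
  split_ifs with h
  · simp only [h, Int.cast_zero, zero_mul, neg_zero, Complex.exp_zero, mul_one]
    rw [intervalIntegral.integral_ofReal, intervalIntegral.integral_sub (by simp) (by simp)]
    simp
    ring
  · have h' : (k : ℂ) * I ≠ 0 := by simp [h]
    have hd : ∀ x ∈ Set.uIcc (0 : ℝ) (2 * Real.pi), HasDerivAt
        (fun x : ℝ => -(((Real.pi : ℂ) - x) / (k * I) - 1 / (k * I) ^ 2) *
          exp (-(k * I) * (x : ℂ)))
        (((Real.pi - x : ℝ) : ℂ) * exp (-(k * I) * (x : ℂ))) x := by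
      intro x _
      have h1 : HasDerivAt (fun x : ℝ => (x : ℂ)) 1 x := Complex.ofRealCLM.hasDerivAt
      have h2 := ((h1.const_sub (Real.pi : ℂ)).div_const (k * I)).sub_const (1 / (k * I) ^ 2)
      have h3 := (h1.const_mul (-(k * I))).cexp
      refine (h2.neg.mul h3).congr_deriv ?_
      simp only [Pi.neg_apply]
      push_cast
      field_simp
      ring
    rw [intervalIntegral.integral_eq_sub_of_hasDerivAt hd
      (Continuous.intervalIntegrable (by fun_prop) _ _), exp_neg_int_mul_two_pi]
    push_cast
    simp
    field_simp
    ring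

-- In the inner integral the mode `0` gives `b 0 * (π - x)`, with Fourier coefficients `2π / (k I)`,
-- while the other modes give a constant and the conjugate modes `(-1) ^ j * exp (j I x)`. By
-- orthogonality the linear part and the constant each contribute `b 0 * b j / j`, whence the factor
-- 2, and the conjugate modes leave only the diagonal `b j ^ 2`.
open Complex in
theorem integral_integral_trig_poly (S : Finset ℤ) (h0 : 0 ∈ S) (b : ℤ → ℂ) :
    ∫ x in (0 : ℝ)..(2 * Real.pi), (∑ j ∈ S, b j * exp (-(j * I) * (x : ℂ))) *
        ∫ y in (0 : ℝ)..(Real.pi - x), ∑ j ∈ S, b j * exp (-(j * I) * (y : ℂ)) =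
      2 * Real.pi / I * ∑ j ∈ S.erase 0, (2 * b 0 * b j - (-1) ^ j * b j ^ 2) / j := by
  have hin : ∀ x : ℝ, ∫ y in (0 : ℝ)..(Real.pi - x), ∑ j ∈ S, b j * exp (-(j * I) * (y : ℂ)) =
      b 0 * ((Real.pi - x : ℝ) : ℂ) + ∑ j ∈ S.erase 0, b j / (j * I) -
        ∑ j ∈ S.erase 0, b j * (-1) ^ j / (j * I) * exp (j * I * x) := by
    intro x
    rw [intervalIntegral.integral_finsetSum
      fun j _ => Continuous.intervalIntegrable (by fun_prop) _ _, ← Finset.add_sum_erase _ _ h0,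
      add_sub_assoc, ← Finset.sum_sub_distrib]
    congr 1
    · simp [mul_comm]
    · refine Finset.sum_congr rfl fun j hj => ?_
      rw [intervalIntegral.integral_const_mul, integral_exp_neg_int_mul (Finset.ne_of_mem_erase hj),
        exp_neg_int_mul_pi_sub]
      simp
      ring
  simp_rw [hin]
  have hsplit : ∀ x : ℝ, (∑ j ∈ S, b j * exp (-(j * I) * (x : ℂ))) *
      (b 0 * ((Real.pi - x : ℝ) : ℂ) + ∑ j ∈ S.erase 0, b j / (j * I) -
        ∑ j ∈ S.erase 0, b j * (-1) ^ j / (j * I) * exp (j * I * x)) =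
      ∑ k ∈ S, (b 0 * b k * (((Real.pi - x : ℝ) : ℂ) * exp (-(k * I) * (x : ℂ))) +
        ((∑ j ∈ S.erase 0, b j / (j * I)) * b k * exp (-(k * I) * (x : ℂ)) -
        ∑ j ∈ S.erase 0, b k * b j * (-1) ^ j / (j * I) *
          exp (-((k - j : ℤ) * I) * (x : ℂ)))) := by
    intro x
    rw [Finset.sum_mul]
    refine Finset.sum_congr rfl fun k _ => ?_
    have : ∀ j : ℤ, exp (-((k - j : ℤ) * I) * (x : ℂ)) =
        exp (-(k * I) * (x : ℂ)) * exp (j * I * x) := fun j => by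
      rw [← Complex.exp_add]; congr 1; push_cast; ring
    simp_rw [this, mul_sub, mul_add, Finset.mul_sum, Finset.sum_mul]
    rw [add_sub_assoc]
    congr 1
    · push_cast
      ring
    · congr 1 <;> exact Finset.sum_congr rfl fun j _ => by ring
  simp_rw [hsplit]
  rw [intervalIntegral.integral_finsetSum
    fun j _ => Continuous.intervalIntegrable (by fun_prop) _ _]
  have hk : ∀ k ∈ S, ∫ x in (0 : ℝ)..(2 * Real.pi), (b 0 * b k * (((Real.pi - x : ℝ) : ℂ) * exp (-(k * I) * (x : ℂ))) +
        ((∑ j ∈ S.erase 0, b j / (j * I)) * b k * exp (-(k * I) * (x : ℂ)) -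
        ∑ j ∈ S.erase 0, b k * b j * (-1) ^ j / (j * I) *
          exp (-((k - j : ℤ) * I) * (x : ℂ)))) =
      if k = 0 then 2 * Real.pi * b 0 * ∑ j ∈ S.erase 0, b j / (j * I)
      else 2 * Real.pi * (b 0 * b k / (k * I) - b k ^ 2 * (-1) ^ k / (k * I)) := by
    intro k hkS
    rw [intervalIntegral.integral_add (Continuous.intervalIntegrable (by fun_prop) _ _)
      (Continuous.intervalIntegrable (by fun_prop) _ _), intervalIntegral.integral_sub
      (Continuous.intervalIntegrable (by fun_prop) _ _)
      (Continuous.intervalIntegrable (by fun_prop) _ _), intervalIntegral.integral_finsetSum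
      fun j _ => Continuous.intervalIntegrable (by fun_prop) _ _]
    simp_rw [intervalIntegral.integral_const_mul, integral_pi_sub_mul_exp_period,
      integral_exp_neg_int_mul_period]
    split_ifs with h
    · subst h
      rw [sub_eq_add_neg, Finset.sum_eq_zero (s := S.erase 0)
        (f := fun j => _ * if (0 : ℤ) - j = 0 then _ else _)]
      · ring
      · intro j hj
        rw [if_neg]
        · simp
        · have := Finset.ne_of_mem_erase hj
          omega
    · rw [Finset.sum_eq_single (s := S.erase 0)
        (f := fun j => _ * if k - j = 0 then _ else _) k]
      · simp
        ring
      · intro j _ hj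
        rw [if_neg (by omega), mul_zero]
      · intro h'
        exact absurd (Finset.mem_erase.2 ⟨h, hkS⟩) h'
  rw [Finset.sum_congr rfl hk, ← Finset.add_sum_erase _ _ h0, if_pos rfl, Finset.mul_sum,
    ← Finset.sum_add_distrib, Finset.mul_sum]
  refine Finset.sum_congr rfl fun j hj => ?_
  have hj := Finset.ne_of_mem_erase hj
  have : (j : ℂ) ≠ 0 := by exact_mod_cast hj
  rw [if_neg hj]
  field_simp
  ring

/-! ### Laplace's method on the triangle. -/

theorem two_sin_mul_two_sin (x y : ℝ) : 2 * Real.sin (x / 2) * (2 * Real.sin (y / 2)) =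
    2 * (Real.cos ((x - y) / 2) - Real.cos ((x + y) / 2)) := by
  rw [sub_div, add_div, Real.cos_sub, Real.cos_add]
  ring

/-- Laplace-type positivity: for large `n` the integral over the triangle is governed by the values
of `g` near the maximum `x = y = π / 2` of `sin (x / 2) sin (y / 2)`. -/
theorem eventually_integral_triangle_pos {g : ℝ → ℝ} (hg : Continuous g) (hg1 : ∀ z, |g z| ≤ 1)
    (hgpi : g Real.pi = 1) :
    ∀ᶠ n : ℕ in atTop, 0 < ∫ x in (0 : ℝ)..Real.pi, ∫ y in (0 : ℝ)..(Real.pi - x),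
      (2 * Real.sin (x / 2)) ^ n * (2 * Real.sin (y / 2)) ^ n * g (x + y) := by
  have hpi := Real.pi_gt_three
  obtain ⟨δ, hδ, hδ1, hgδ⟩ : ∃ δ : ℝ, 0 < δ ∧ δ < 1 ∧
      ∀ z, Real.pi - δ ≤ z → z ≤ Real.pi → 1 / 2 ≤ g z := by
    have h1 : ∀ᶠ z in 𝓝 Real.pi, 1 / 2 < g z :=
      hg.continuousAt.eventually (lt_mem_nhds (by rw [hgpi]; norm_num))
    obtain ⟨ε, hε, h⟩ := Metric.eventually_nhds_iff.1 h1
    refine ⟨min (ε / 2) (1 / 2), by positivity, by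
      have := min_le_right (ε / 2) (1 / 2); linarith, fun z hz hz' => (h ?_).le⟩
    have := min_le_left (ε / 2) (1 / 2)
    rw [Real.dist_eq, abs_lt]
    constructor <;> linarith
  -- `M` bounds `4 sin (x/2) sin (y/2)` on the part `x + y ≤ π - δ`, where the sign of `g` is
  -- unknown. On the square `[a, π/2]²`, of side `δ / 4` and inside the triangle, the product is at
  -- least `q`, and `M < q`.
  set M : ℝ := 2 * (1 - Real.cos ((Real.pi - δ) / 2)) with hM
  set a : ℝ := Real.pi / 2 - δ / 4 with ha
  set q : ℝ := 2 * Real.sin (a / 2) * (2 * Real.sin (a / 2)) with hq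
  have hM0 : 0 ≤ M := by have := Real.cos_le_one ((Real.pi - δ) / 2); linarith
  have hMq : M < q := by
    rw [hq, two_sin_mul_two_sin, sub_self, zero_div, Real.cos_zero, hM, add_self_div_two]
    have := Real.cos_lt_cos_of_nonneg_of_le_pi (x := (Real.pi - δ) / 2) (y := a)
      (by linarith) (by linarith) (by linarith)
    linarith
  have hq0 : 0 < q := hM0.trans_lt hMq
  have hs0 : ∀ x, 0 ≤ x → x ≤ Real.pi → 0 ≤ 2 * Real.sin (x / 2) := fun x h h' =>
    mul_nonneg zero_le_two (Real.sin_nonneg_of_nonneg_of_le_pi (by linarith) (by linarith))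
  have hlim := tendsto_pow_atTop_nhds_zero_of_lt_one (div_nonneg hM0 hq0.le)
    ((div_lt_one hq0).2 hMq)
  -- The threshold makes `(1/2) (δ/4)² q^n`, the guaranteed main term, exceed `2 π² M^n`, the total
  -- error.
  have hev := hlim.eventually (gt_mem_nhds
    (show 0 < (δ / 4) ^ 2 / (4 * Real.pi ^ 2) by positivity))
  filter_upwards [hev] with n hn
  rw [div_pow, div_lt_div_iff₀ (pow_pos hq0 n) (by positivity)] at hn
  set s : ℝ → ℝ := fun x => 2 * Real.sin (x / 2) with hs
  have hsc : Continuous s := by fun_prop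
  have hK : ∀ x y, s x ^ n * s y ^ n = (s x * s y) ^ n := fun x y => (mul_pow _ _ _).symm
  have hcont : ∀ φ : ℝ → ℝ → ℝ, Continuous (Function.uncurry φ) →
      Continuous fun x => ∫ y in (0 : ℝ)..(Real.pi - x), φ x y := fun φ hφ =>
    intervalIntegral.continuous_parametric_intervalIntegral_of_continuous hφ (by fun_prop)
  have hc1 := hcont (fun x y => s x ^ n * s y ^ n * g (x + y))
    (by simp only [Function.uncurry_def]; fun_prop)
  have hc2 := hcont (fun x y => s x ^ n * s y ^ n)
    (by simp only [Function.uncurry_def]; fun_prop)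
  -- Near the hypotenuse `g ≥ 1/2`; elsewhere the kernel is at most `M ^ n` and `g ≥ -1`, so
  -- subtracting `2 * M ^ n` covers both cases.
  have hpt : ∀ x ∈ Set.Icc 0 Real.pi, ∀ y ∈ Set.Icc 0 (Real.pi - x),
      1 / 2 * (s x ^ n * s y ^ n) - 2 * M ^ n ≤ s x ^ n * s y ^ n * g (x + y) := by
    intro x hx y hy
    have hK0 : 0 ≤ s x ^ n * s y ^ n :=
      mul_nonneg (pow_nonneg (hs0 x hx.1 hx.2) n)
        (pow_nonneg (hs0 y hy.1 (by linarith [hy.2, hx.1])) n)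
    have hMn := pow_nonneg hM0 n
    rcases le_or_gt (Real.pi - δ) (x + y) with h | h
    · have := mul_le_mul_of_nonneg_left (hgδ _ h (by linarith [hy.2])) hK0
      linarith
    · have h1 : s x ^ n * s y ^ n ≤ M ^ n := by
        rw [hK]
        refine pow_le_pow_left₀ (mul_nonneg (hs0 x hx.1 hx.2)
          (hs0 y hy.1 (by linarith [hy.2, hx.1]))) ?_ n
        have h2 := two_sin_mul_two_sin x y
        have h3 := Real.cos_le_one ((x - y) / 2)
        have h4 := Real.cos_le_cos_of_nonneg_of_le_pi (x := (x + y) / 2)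
          (y := (Real.pi - δ) / 2) (by linarith [hx.1, hy.1]) (by linarith) (by linarith)
        linarith
      have h2 := mul_le_mul_of_nonneg_left (neg_le_of_abs_le (hg1 (x + y))) hK0
      linarith
  have hin : ∀ x ∈ Set.Icc 0 Real.pi,
      1 / 2 * (∫ y in (0 : ℝ)..(Real.pi - x), s x ^ n * s y ^ n) - 2 * Real.pi * M ^ n ≤
      ∫ y in (0 : ℝ)..(Real.pi - x), s x ^ n * s y ^ n * g (x + y) := by
    intro x hx
    have h1 := intervalIntegral.integral_mono_on (μ := MeasureTheory.volume)
      (sub_nonneg.2 hx.2)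
      (Continuous.intervalIntegrable (by fun_prop) _ _)
      (Continuous.intervalIntegrable (by fun_prop) _ _) (hpt x hx)
    rw [intervalIntegral.integral_sub (Continuous.intervalIntegrable (by fun_prop) _ _)
      (by simp), intervalIntegral.integral_const_mul, intervalIntegral.integral_const] at h1
    refine le_trans ?_ h1
    simp only [smul_eq_mul, sub_zero]
    have := mul_nonneg hx.1 (pow_nonneg hM0 n)
    nlinarith
  have hJ0 : ∀ x ∈ Set.Icc 0 Real.pi, 0 ≤ ∫ y in (0 : ℝ)..(Real.pi - x), s x ^ n * s y ^ n := by
    intro x hx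
    refine intervalIntegral.integral_nonneg (sub_nonneg.2 hx.2) fun y hy => ?_
    exact mul_nonneg (pow_nonneg (hs0 x hx.1 hx.2) n)
        (pow_nonneg (hs0 y hy.1 (by linarith [hy.2, hx.1])) n)
  have hmono : ∀ x, a ≤ x → x ≤ Real.pi / 2 → s a ≤ s x := fun x h h' => by
    have := Real.sin_le_sin_of_le_of_le_pi_div_two (x := a / 2) (y := x / 2)
      (by linarith) (by linarith) (by linarith)
    simp only [hs]
    linarith
  have hJ1 : ∀ x ∈ Set.Icc a (Real.pi / 2),
      δ / 4 * q ^ n ≤ ∫ y in (0 : ℝ)..(Real.pi - x), s x ^ n * s y ^ n := by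
    intro x hx
    have hx0 : 0 ≤ x := by linarith [hx.1]
    have hsa := hs0 a (by linarith) (by linarith)
    have h1 : ∫ _ in a..(Real.pi / 2), q ^ n ≤ ∫ y in a..(Real.pi / 2), s x ^ n * s y ^ n := by
      refine intervalIntegral.integral_mono_on (by linarith) (by simp)
        (Continuous.intervalIntegrable (by fun_prop) _ _) fun y hy => ?_
      rw [hK]
      exact pow_le_pow_left₀ hq0.le (mul_le_mul (hmono x hx.1 hx.2) (hmono y hy.1 hy.2) hsa
        (hsa.trans (hmono x hx.1 hx.2))) n
    have h2 : ∫ y in a..(Real.pi / 2), s x ^ n * s y ^ n ≤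
        ∫ y in (0 : ℝ)..(Real.pi - x), s x ^ n * s y ^ n := by
      refine intervalIntegral.integral_mono_interval (by linarith) (by linarith)
        (by linarith [hx.2]) ?_ (Continuous.intervalIntegrable (by fun_prop) _ _)
      rw [Filter.EventuallyLE, MeasureTheory.ae_restrict_iff' measurableSet_Ioc]
      refine Filter.Eventually.of_forall fun y hy => ?_
      exact mul_nonneg (pow_nonneg (hs0 x hx0 (by linarith [hx.2])) n)
        (pow_nonneg (hs0 y hy.1.le (by linarith [hy.2])) n)
    refine le_trans (le_of_eq ?_) (h1.trans h2)
    rw [intervalIntegral.integral_const, smul_eq_mul]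
    congr 1
    linarith
  have hJ : (δ / 4) * (δ / 4 * q ^ n) ≤
      ∫ x in (0 : ℝ)..Real.pi, ∫ y in (0 : ℝ)..(Real.pi - x), s x ^ n * s y ^ n := by
    have h1 := intervalIntegral.integral_mono_on (μ := MeasureTheory.volume)
      (show a ≤ Real.pi / 2 by linarith) (by simp)
      (hc2.intervalIntegrable _ _) hJ1
    have h2 : ∫ x in a..(Real.pi / 2), ∫ y in (0 : ℝ)..(Real.pi - x), s x ^ n * s y ^ n ≤
        ∫ x in (0 : ℝ)..Real.pi, ∫ y in (0 : ℝ)..(Real.pi - x), s x ^ n * s y ^ n := by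
      refine intervalIntegral.integral_mono_interval (by linarith) (by linarith)
        (by linarith) ?_ (hc2.intervalIntegrable _ _)
      rw [Filter.EventuallyLE, MeasureTheory.ae_restrict_iff' measurableSet_Ioc]
      exact Filter.Eventually.of_forall fun x hx => hJ0 x ⟨hx.1.le, hx.2⟩
    refine le_trans (le_of_eq ?_) (h1.trans h2)
    rw [intervalIntegral.integral_const, smul_eq_mul]
    congr 1
    linarith
  have hfin := intervalIntegral.integral_mono_on (μ := MeasureTheory.volume) Real.pi_pos.le
    (Continuous.intervalIntegrable (by fun_prop) _ _) (hc1.intervalIntegrable _ _) hin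
  refine lt_of_lt_of_le ?_ hfin
  rw [intervalIntegral.integral_sub (Continuous.intervalIntegrable (by fun_prop) _ _)
      (by simp), intervalIntegral.integral_const_mul, intervalIntegral.integral_const]
  simp only [smul_eq_mul, sub_zero]
  nlinarith

/-! ### The alternating binomial sum as an integral. -/

/-- The binomial coefficient `C(l + r, l + j)`, for `j` between `-l` and `r`. -/
noncomputable def shiftedChoose (l r : ℕ) (j : ℤ) : ℝ := ((l + r).choose (l + j).toNat : ℝ)

theorem sum_Icc_eq_sum_range {A : Type*} [AddCommMonoid A] (l r : ℕ) (F : ℤ → A) :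
    ∑ j ∈ Finset.Icc (-(l : ℤ)) (r : ℤ), F j = ∑ k ∈ Finset.range (l + r + 1), F (k - l) := by
  refine Finset.sum_nbij' (fun j => (l + j).toNat) (fun k => (k : ℤ) - l) ?_ ?_ ?_ ?_ ?_
  · intro j hj
    simp only [Finset.mem_Icc, Finset.mem_range] at *
    omega
  · intro j hj
    simp only [Finset.mem_Icc, Finset.mem_range] at *
    omega
  · intro j hj
    simp only [Finset.mem_Icc] at *
    omega
  · intro j hj
    simp only [Finset.mem_range] at *
    omega
  · intro j hj
    simp only [Finset.mem_Icc] at *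
    congr 1
    omega

open Complex in
theorem one_sub_exp_neg (x : ℝ) :
    1 - exp (-(I * x)) = exp (-(I * x / 2)) * (I * (2 * Real.sin (x / 2) : ℝ)) := by
  have h2 : exp (-(I * x)) = exp (-(I * x / 2)) * exp (-(I * x / 2)) := by
    rw [← Complex.exp_add]; congr 1; ring
  have h3 : exp (-(I * x / 2)) * exp (I * x / 2) = 1 := by
    rw [← Complex.exp_add]; simp
  push_cast
  rw [Complex.sin, h2, ← h3]
  have h4 : exp (-((x : ℂ) / 2) * I) = exp (-(I * x / 2)) := by congr 1; ring
  have h5 : exp ((x : ℂ) / 2 * I) = exp (I * x / 2) := by congr 1; ring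
  rw [h4, h5]
  linear_combination (exp (-(I * x / 2)) * exp (I * x / 2) -
    exp (-(I * x / 2)) * exp (-(I * x / 2))) * Complex.I_mul_I

-- The binomial theorem gives `(-1)^l e^{ilx} (1 - e^{-ix})^(l+r)`; extracting the half-angle phase
-- from `1 - e^{-ix}` leaves a power of a real sine.
open Complex in
theorem sum_shiftedChoose_exp (l r : ℕ) (x : ℝ) :
    ∑ j ∈ Finset.Icc (-(l : ℤ)) (r : ℤ),
      ((-1) ^ j * (shiftedChoose l r j : ℂ)) * exp (-(j * I) * (x : ℂ)) =
    ((-1) ^ l * I ^ (l + r)) * (((2 * Real.sin (x / 2)) ^ (l + r) : ℝ) : ℂ) *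
      exp (I * ((((l : ℝ) - r) * x / 2 : ℝ) : ℂ)) := by
  rw [sum_Icc_eq_sum_range]
  have h1 : ∀ k ∈ Finset.range (l + r + 1),
      ((-1) ^ ((k : ℤ) - l) * (shiftedChoose l r (k - l) : ℂ)) *
        exp (-(((k : ℤ) - l : ℤ) * I) * (x : ℂ)) =
      ((-1) ^ l * exp (l * (I * x))) *
        ((-exp (-(I * x))) ^ k * 1 ^ (l + r - k) * ((l + r).choose k : ℂ)) := by
    intro k _
    have h2 : ((l : ℤ) + ((k : ℤ) - l)).toNat = k := by omega
    have h3 : ((-1 : ℂ)) ^ ((k : ℤ) - l) = (-1) ^ k * (-1) ^ l := by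
      rw [zpow_sub₀ (by norm_num), zpow_natCast, zpow_natCast, div_eq_mul_inv, ← inv_pow]
      norm_num
    have h4 : exp (-(((k : ℤ) - l : ℤ) * I) * (x : ℂ)) = exp (l * (I * x)) * exp (-(I * x)) ^ k := by
      rw [← Complex.exp_nat_mul, ← Complex.exp_add]
      congr 1
      push_cast
      ring
    rw [shiftedChoose, h2, h3, h4, neg_pow (exp _)]
    push_cast
    ring
  rw [Finset.sum_congr rfl h1, ← Finset.mul_sum, ← add_pow, neg_add_eq_sub, one_sub_exp_neg,
    mul_pow, mul_pow, ← Complex.exp_nat_mul]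
  have h5 : exp (I * ((((l : ℝ) - r) * x / 2 : ℝ) : ℂ)) = exp (l * (I * x)) *
      exp (((l + r : ℕ) : ℂ) * -(I * x / 2)) := by
    rw [← Complex.exp_add]
    congr 1
    push_cast
    ring
  rw [h5]
  push_cast
  ring

/-- The alternating sum of the theorem as an integral over a triangle. -/
theorem sum_shiftedChoose_eq_integral (r m : ℕ) (hm : Odd m) :
    ∑ j ∈ (Finset.Icc (-((r + m : ℕ) : ℤ)) (r : ℤ)).erase 0,
      (-1) ^ j * (2 * shiftedChoose (r + m) r 0 * shiftedChoose (r + m) r j -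
        shiftedChoose (r + m) r j ^ 2) / j =
    1 / Real.pi * ∫ x in (0 : ℝ)..Real.pi, ∫ y in (0 : ℝ)..(Real.pi - x),
      (2 * Real.sin (x / 2)) ^ (r + m + r) * (2 * Real.sin (y / 2)) ^ (r + m + r) *
        Real.sin (m * (x + y) / 2) := by
  set n := r + m + r with hn
  have hnodd : Odd n := by
    obtain ⟨k, rfl⟩ := hm
    exact ⟨r + k, by omega⟩
  set A : ℤ → ℝ := shiftedChoose (r + m) r with hA
  set s : ℝ → ℝ := fun x => 2 * Real.sin (x / 2) with hs
  have hsc : Continuous s := by fun_prop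
  set S := ∑ j ∈ (Finset.Icc (-((r + m : ℕ) : ℤ)) (r : ℤ)).erase 0,
      (-1) ^ j * (2 * A 0 * A j - A j ^ 2) / j with hS
  have h1 := integral_integral_trig_poly (Finset.Icc (-((r + m : ℕ) : ℤ)) (r : ℤ))
    (by simp) (fun j => (-1) ^ j * (A j : ℂ))
  have hsq : ∀ j : ℤ, ((-1 : ℂ) ^ j) ^ 2 = 1 := fun j => by
    rw [← zpow_natCast, ← zpow_mul, mul_comm, zpow_mul]; norm_num
  have h2 : ∑ j ∈ (Finset.Icc (-((r + m : ℕ) : ℤ)) (r : ℤ)).erase 0,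
      (2 * ((-1) ^ (0 : ℤ) * (A 0 : ℂ)) * ((-1) ^ j * (A j : ℂ)) -
        (-1) ^ j * ((-1) ^ j * (A j : ℂ)) ^ 2) / j = (S : ℂ) := by
    rw [hS]
    push_cast
    refine Finset.sum_congr rfl fun j _ => ?_
    rw [mul_pow, hsq]
    simp
    ring
  rw [h2] at h1
  simp_rw [hA, sum_shiftedChoose_exp] at h1
  -- The constant phase squares to `I ^ (2n) = (-1) ^ n`, and `n` is odd.
  have hκ : ((-1 : ℂ) ^ (r + m) * Complex.I ^ n) * ((-1 : ℂ) ^ (r + m) * Complex.I ^ n) = -1 := by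
    have : ((-1 : ℂ) ^ (r + m)) * ((-1 : ℂ) ^ (r + m)) = 1 := by
      rw [← pow_add]; exact Even.neg_one_pow ⟨_, rfl⟩
    have h' : Complex.I ^ n * Complex.I ^ n = -1 := by
      rw [← mul_pow, Complex.I_mul_I]; exact hnodd.neg_one_pow
    linear_combination Complex.I ^ n * Complex.I ^ n * this + h'
  have hpush : ∀ x y : ℝ, ((-1 : ℂ) ^ (r + m) * Complex.I ^ n) * ((s x ^ n : ℝ) : ℂ) *
        Complex.exp (Complex.I * (((((r + m : ℕ) : ℝ) - r) * x / 2 : ℝ) : ℂ)) *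
      (((-1 : ℂ) ^ (r + m) * Complex.I ^ n) * ((s y ^ n : ℝ) : ℂ) *
        Complex.exp (Complex.I * (((((r + m : ℕ) : ℝ) - r) * y / 2 : ℝ) : ℂ))) =
      -(((s x ^ n * s y ^ n : ℝ) : ℂ) *
        Complex.exp (((m * (x + y) / 2 : ℝ) : ℂ) * Complex.I)) := by
    intro x y
    have : Complex.exp (((m * (x + y) / 2 : ℝ) : ℂ) * Complex.I) =
        Complex.exp (Complex.I * (((((r + m : ℕ) : ℝ) - r) * x / 2 : ℝ) : ℂ)) *
        Complex.exp (Complex.I * (((((r + m : ℕ) : ℝ) - r) * y / 2 : ℝ) : ℂ)) := by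
      rw [← Complex.exp_add]
      congr 1
      push_cast
      ring
    rw [this]
    simp only [Complex.ofReal_mul, Complex.ofReal_pow]
    linear_combination ((s x : ℂ) ^ n * (s y : ℂ) ^ n *
      Complex.exp (Complex.I * (((((r + m : ℕ) : ℝ) - r) * x / 2 : ℝ) : ℂ)) *
        Complex.exp (Complex.I * (((((r + m : ℕ) : ℝ) - r) * y / 2 : ℝ) : ℂ))) * hκ
  simp_rw [← intervalIntegral.integral_const_mul] at h1
  change ∫ x in (0 : ℝ)..(2 * Real.pi), ∫ y in (0 : ℝ)..(Real.pi - x),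
    ((-1 : ℂ) ^ (r + m) * Complex.I ^ n) * ((s x ^ n : ℝ) : ℂ) *
        Complex.exp (Complex.I * (((((r + m : ℕ) : ℝ) - r) * x / 2 : ℝ) : ℂ)) *
      (((-1 : ℂ) ^ (r + m) * Complex.I ^ n) * ((s y ^ n : ℝ) : ℂ) *
        Complex.exp (Complex.I * (((((r + m : ℕ) : ℝ) - r) * y / 2 : ℝ) : ℂ))) = _ at h1
  simp_rw [hpush] at h1
  set Φ : ℝ → ℝ := fun x => ∫ y in (0 : ℝ)..(Real.pi - x),
    s x ^ n * s y ^ n * Real.sin (m * (x + y) / 2) with hΦ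
  have hΦc : Continuous Φ :=
    intervalIntegral.continuous_parametric_intervalIntegral_of_continuous
      (f := fun x y => s x ^ n * s y ^ n * Real.sin (m * (x + y) / 2))
      (by simp only [Function.uncurry_def]; fun_prop) (by fun_prop)
  have him := congrArg Complex.im h1
  have hcc : Continuous fun x : ℝ => ∫ y in (0 : ℝ)..(Real.pi - x),
      -(((s x ^ n * s y ^ n : ℝ) : ℂ) *
        Complex.exp (((m * (x + y) / 2 : ℝ) : ℂ) * Complex.I)) :=
    intervalIntegral.continuous_parametric_intervalIntegral_of_continuous
      (f := fun x y : ℝ => -(((s x ^ n * s y ^ n : ℝ) : ℂ) *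
        Complex.exp (((m * (x + y) / 2 : ℝ) : ℂ) * Complex.I)))
      (by simp only [Function.uncurry_def]; fun_prop) (by fun_prop)
  -- The sum `S` is real and enters with the factor `2π / I`, so imaginary parts isolate it and
  -- replace the exponential by a sine.
  rw [← Complex.imCLM_apply, ← ContinuousLinearMap.intervalIntegral_comp_comm _
    (hcc.intervalIntegrable _ _)] at him
  have hinner : ∀ x : ℝ, Complex.imCLM (∫ y in (0 : ℝ)..(Real.pi - x),
      -(((s x ^ n * s y ^ n : ℝ) : ℂ) *
        Complex.exp (((m * (x + y) / 2 : ℝ) : ℂ) * Complex.I))) = -Φ x := by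
    intro x
    rw [← ContinuousLinearMap.intervalIntegral_comp_comm _
      (Continuous.intervalIntegrable (by fun_prop) _ _), hΦ, ← intervalIntegral.integral_neg]
    congr 1
    funext y
    rw [Complex.imCLM_apply, Complex.neg_im, Complex.im_ofReal_mul, Complex.exp_ofReal_mul_I_im]
  simp_rw [hinner] at him
  have hrhs : (2 * (Real.pi : ℂ) / Complex.I * (S : ℂ)).im = -(2 * Real.pi * S) := by
    rw [Complex.div_I]
    simp
  rw [hrhs, intervalIntegral.integral_neg, neg_inj] at him
  -- Under `x ↦ 2π - x`, `y ↦ -y`, oddness of `n` makes `s y ^ n` change sign, which cancels the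
  -- sign from `dy`; oddness of `m` preserves `sin (m (x + y) / 2)`. The integral over `[0, 2π]` is
  -- thus twice that over `[0, π]`.
  have hrefl : ∀ x, Φ (2 * Real.pi - x) = Φ x := by
    intro x
    have hsx : s (2 * Real.pi - x) = s x := by
      simp only [hs]
      rw [show (2 * Real.pi - x) / 2 = Real.pi - x / 2 by ring, Real.sin_pi_sub]
    have h3 := intervalIntegral.integral_comp_neg (a := (0 : ℝ)) (b := Real.pi - x)
      fun y => s x ^ n * s y ^ n * Real.sin (m * (2 * Real.pi - x + y) / 2)
    simp only [hΦ, hsx]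
    rw [show Real.pi - (2 * Real.pi - x) = -(Real.pi - x) by ring,
      intervalIntegral.integral_symm, ← neg_zero (G := ℝ), ← h3,
      ← intervalIntegral.integral_neg, neg_zero]
    congr 1
    funext y
    have h4 : s (-y) ^ n = -s y ^ n := by
      rw [← hnodd.neg_pow]
      congr 1
      simp only [hs]
      rw [neg_div, Real.sin_neg]
      ring
    have h5 : Real.sin (m * (2 * Real.pi - x + -y) / 2) = Real.sin (m * (x + y) / 2) := by
      obtain ⟨k, rfl⟩ := hm
      rw [show ((2 * k + 1 : ℕ) : ℝ) * (2 * Real.pi - x + -y) / 2 =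
        Real.pi - ((2 * k + 1 : ℕ) : ℝ) * (x + y) / 2 + k * (2 * Real.pi) by push_cast; ring,
        Real.sin_add_nat_mul_two_pi, Real.sin_pi_sub]
    rw [h4, h5]
    ring
  have hdouble : ∫ x in (0 : ℝ)..(2 * Real.pi), Φ x = 2 * ∫ x in (0 : ℝ)..Real.pi, Φ x := by
    rw [← intervalIntegral.integral_add_adjacent_intervals (b := Real.pi)
      (hΦc.intervalIntegrable _ _) (hΦc.intervalIntegrable _ _)]
    have h3 := intervalIntegral.integral_comp_sub_left (a := (0 : ℝ)) (b := Real.pi) Φ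
      (2 * Real.pi)
    simp_rw [hrefl] at h3
    rw [h3, show 2 * Real.pi - Real.pi = Real.pi by ring, sub_zero]
    ring
  rw [hdouble] at him
  have := Real.pi_pos
  change S = 1 / Real.pi * ∫ x in (0 : ℝ)..Real.pi, Φ x
  field_simp
  linarith

/-! ### Lagrange and Hermite polynomials of the stencil. -/

open Polynomial

theorem intCast_injOn (S : Finset ℤ) : Set.InjOn (fun i : ℤ => (i : ℝ)) S :=
  fun _ _ _ _ h => Int.cast_injective h

theorem prod_range_erase_sub (k q : ℕ) :
    ∏ i ∈ (Finset.range (k + q + 1)).erase k, ((k : ℝ) - i) =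
      (-1) ^ q * (k.factorial * q.factorial) := by
  induction q with
  | zero =>
    rw [add_zero, Finset.range_add_one, Finset.erase_insert Finset.notMem_range_self,
      ← Finset.prod_range_reflect, ← Finset.prod_range_add_one_eq_factorial]
    simp only [pow_zero, one_mul, Nat.factorial_zero, Nat.cast_one, mul_one, Nat.cast_prod]
    refine Finset.prod_congr rfl fun i hi => ?_
    have := Finset.mem_range.1 hi
    rw [Nat.sub_sub, Nat.cast_sub (by omega)]
    push_cast
    ring
  | succ q ih =>
    have : (Finset.range (k + (q + 1) + 1)).erase k =
        insert (k + q + 1) ((Finset.range (k + q + 1)).erase k) := by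
      ext i
      simp only [Finset.mem_erase, Finset.mem_insert, Finset.mem_range]
      omega
    rw [this, Finset.prod_insert (by simp), ih, Nat.factorial_succ]
    push_cast
    ring

/-- The node polynomial of the stencil without the node `j`. -/
noncomputable def stencilNodal (l r : ℕ) (j : ℤ) : ℝ[X] :=
  Lagrange.nodal ((Finset.Icc (-(l : ℤ)) (r : ℤ)).erase j) fun i => (i : ℝ)

/-- The Lagrange basis polynomial of the stencil at the node `j`. -/
noncomputable def stencilBasis (l r : ℕ) (j : ℤ) : ℝ[X] :=
  Lagrange.basis (Finset.Icc (-(l : ℤ)) (r : ℤ)) (fun i => (i : ℝ)) j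

/-- The product of `j - i` over the other nodes is `(-1)^(r-j) (l+j)! (r-j)!`, so its inverse is a
signed binomial coefficient up to a common factor. -/
theorem eval_stencilNodal_mul_shiftedChoose {l r : ℕ} {j : ℤ}
    (hj : j ∈ Finset.Icc (-(l : ℤ)) (r : ℤ)) :
    (stencilNodal l r j).eval (j : ℝ) * shiftedChoose l r j =
      (-1) ^ (r - j) * ((l + r).factorial : ℝ) := by
  rw [Finset.mem_Icc] at hj
  obtain ⟨k, hk⟩ : ∃ k : ℕ, (l : ℤ) + j = k := ⟨(l + j).toNat, by omega⟩
  obtain ⟨q, hq⟩ : ∃ q : ℕ, (r : ℤ) - j = q := ⟨(r - j).toNat, by omega⟩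
  have hn : l + r = k + q := by omega
  have h1 : (stencilNodal l r j).eval (j : ℝ) =
      ∏ i ∈ (Finset.range (k + q + 1)).erase k, ((k : ℝ) - i) := by
    rw [stencilNodal, Lagrange.eval_nodal]
    refine Finset.prod_nbij' (fun i => (l + i).toNat) (fun i => (i : ℤ) - l) ?_ ?_ ?_ ?_ ?_
    · intro i hi
      simp only [Finset.mem_erase, Finset.mem_Icc, Finset.mem_range] at *
      omega
    · intro i hi
      simp only [Finset.mem_erase, Finset.mem_Icc, Finset.mem_range] at *
      omega
    · intro i hi
      simp only [Finset.mem_erase, Finset.mem_Icc] at *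
      omega
    · intro i hi
      simp only [Finset.mem_erase, Finset.mem_range] at *
      omega
    · intro i hi
      simp only [Finset.mem_erase, Finset.mem_Icc] at *
      have h2 : ((l + i).toNat : ℤ) = l + i := by omega
      have h2' : (((l + i).toNat : ℤ) : ℝ) = ((l + i : ℤ) : ℝ) := by rw [h2]
      have h3' : ((l + j : ℤ) : ℝ) = ((k : ℤ) : ℝ) := by rw [hk]
      push_cast at h2' h3'
      rw [h2', ← h3']
      ring
  rw [h1, prod_range_erase_sub, hq, zpow_natCast, shiftedChoose, hk, Int.toNat_natCast, hn]
  have := Nat.choose_mul_factorial_mul_factorial (Nat.le_add_right k q)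
  rw [Nat.add_sub_cancel_left] at this
  rw [← this]
  push_cast
  ring

theorem shiftedChoose_pos {l r : ℕ} {j : ℤ} (hj : j ∈ Finset.Icc (-(l : ℤ)) (r : ℤ)) :
    0 < shiftedChoose l r j := by
  rw [Finset.mem_Icc] at hj
  exact Nat.cast_pos.2 (Nat.choose_pos (by omega))

theorem eval_stencilNodal_ne_zero {l r : ℕ} {j : ℤ} (hj : j ∈ Finset.Icc (-(l : ℤ)) (r : ℤ)) :
    (stencilNodal l r j).eval (j : ℝ) ≠ 0 := by
  intro h
  have h1 := eval_stencilNodal_mul_shiftedChoose hj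
  rw [h, zero_mul] at h1
  have h2 : (-1 : ℝ) ^ ((r : ℤ) - j) ≠ 0 := zpow_ne_zero _ (by norm_num)
  have h3 : ((l + r).factorial : ℝ) ≠ 0 := by positivity
  exact mul_ne_zero h2 h3 h1.symm

theorem stencilBasis_eq {l r : ℕ} {j : ℤ} :
    stencilBasis l r j = C ((stencilNodal l r j).eval (j : ℝ))⁻¹ * stencilNodal l r j := by
  rw [stencilBasis, Lagrange.basis, stencilNodal, Lagrange.eval_nodal, Lagrange.nodal,
    ← Finset.prod_inv_distrib, map_prod, ← Finset.prod_mul_distrib]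
  rfl

theorem zero_mem_stencil (l r : ℕ) : (0 : ℤ) ∈ Finset.Icc (-(l : ℤ)) (r : ℤ) := by simp

/-- Since `0` is a root of the basis polynomial, its derivative there is the product over the
remaining nodes. That product is the nodal product at `0` without its factor `-j`, so a ratio of
binomial coefficients results. -/
theorem eval_zero_derivative_stencilBasis {l r : ℕ} {j : ℤ}
    (hj : j ∈ (Finset.Icc (-(l : ℤ)) (r : ℤ)).erase 0) :
    (stencilBasis l r j).derivative.eval 0 =
      -((-1) ^ j * shiftedChoose l r j / (shiftedChoose l r 0 * j)) := by
  have hj0 := Finset.ne_of_mem_erase hj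
  have hjS := Finset.mem_of_mem_erase hj
  have hj0' : (j : ℝ) ≠ 0 := by exact_mod_cast hj0
  have h0 : (0 : ℤ) ∈ (Finset.Icc (-(l : ℤ)) (r : ℤ)).erase j :=
    Finset.mem_erase.2 ⟨hj0.symm, zero_mem_stencil l r⟩
  have h1 := Lagrange.eval_nodal_derivative_eval_node_eq (v := fun i : ℤ => (i : ℝ)) h0
  have h2 : (stencilNodal l r 0).eval 0 = -(j : ℝ) * (Lagrange.nodal
      (((Finset.Icc (-(l : ℤ)) (r : ℤ)).erase j).erase 0) fun i : ℤ => (i : ℝ)).eval 0 := by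
    rw [stencilNodal, Lagrange.eval_nodal, Lagrange.eval_nodal, ← Finset.mul_prod_erase _ _ hj,
      Finset.erase_right_comm]
    simp
  have h3 := eval_stencilNodal_mul_shiftedChoose hjS
  have h4 := eval_stencilNodal_mul_shiftedChoose (zero_mem_stencil l r)
  have h5 := eval_stencilNodal_ne_zero hjS
  have h6 := (shiftedChoose_pos (zero_mem_stencil l r)).ne'
  simp only [Int.cast_zero] at h1 h4
  rw [stencilBasis_eq, derivative_C_mul, eval_C_mul, stencilNodal, h1, ← stencilNodal]
  rw [h2] at h4
  have h7 : (-1 : ℝ) ^ ((r : ℤ) - 0) = (-1) ^ ((r : ℤ) - j) * (-1) ^ j := by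
    rw [← zpow_add₀ (by norm_num)]
    congr 1
    ring
  rw [h7] at h4
  field_simp
  linear_combination -h4 + (-1 : ℝ) ^ j * h3

theorem eval_stencilBasis {l r : ℕ} {i j : ℤ} (hi : i ∈ Finset.Icc (-(l : ℤ)) (r : ℤ)) :
    (stencilBasis l r j).eval (i : ℝ) = if i = j then 1 else 0 := by
  split_ifs with h
  · subst h
    exact Lagrange.eval_basis_self (v := fun i : ℤ => (i : ℝ)) (intCast_injOn _) hi
  · exact Lagrange.eval_basis_of_ne (v := fun i : ℤ => (i : ℝ)) (Ne.symm h) hi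

/-- The Hermite polynomial of the stencil that vanishes at all nodes and whose derivative is `1` at
the node `j` and `0` at all others. -/
noncomputable def hermiteSlope (l r : ℕ) (j : ℤ) : ℝ[X] :=
  (X - C (j : ℝ)) * stencilBasis l r j ^ 2

theorem card_stencil (l r : ℕ) : (Finset.Icc (-(l : ℤ)) (r : ℤ)).card = l + r + 1 := by
  rw [Int.card_Icc]
  omega

theorem natDegree_hermiteSlope_le {l r : ℕ} {j : ℤ} (hj : j ∈ Finset.Icc (-(l : ℤ)) (r : ℤ)) :
    (hermiteSlope l r j).natDegree ≤ l + r + l + r + 1 := by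
  refine natDegree_mul_le.trans ?_
  have h1 : (stencilBasis l r j).natDegree = l + r := by
    rw [stencilBasis, Lagrange.natDegree_basis (intCast_injOn _) hj, card_stencil]
    rfl
  have h2 := natDegree_pow_le (p := stencilBasis l r j) (n := 2)
  rw [h1] at h2
  rw [natDegree_X_sub_C]
  omega

theorem derivative_hermiteSlope (l r : ℕ) (j : ℤ) : (hermiteSlope l r j).derivative =
    stencilBasis l r j ^ 2 +
      2 * (X - C (j : ℝ)) * stencilBasis l r j * (stencilBasis l r j).derivative := by
  simp only [hermiteSlope, derivative_mul, derivative_pow, derivative_sub, derivative_X,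
    derivative_C]
  simp only [sub_zero, one_mul, Nat.cast_ofNat, Nat.add_one_sub_one, pow_one, C_ofNat]
  ring

/-- The coefficient of degree 1 of `U'` is `U''(0)`, the value an optimal functional must take on
`U'`. -/
theorem coeff_one_derivative_hermiteSlope (l r : ℕ) (j : ℤ) :
    (hermiteSlope l r j).derivative.coeff 1 =
      4 * (stencilBasis l r j).eval 0 * (stencilBasis l r j).derivative.eval 0
      - 2 * j * ((stencilBasis l r j).derivative.eval 0 ^ 2 +
        (stencilBasis l r j).eval 0 * (stencilBasis l r j).derivative.derivative.eval 0) := by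
  have h := coeff_derivative (hermiteSlope l r j).derivative 0
  rw [zero_add, Nat.cast_zero, zero_add, mul_one, coeff_zero_eq_eval_zero] at h
  rw [← h, derivative_hermiteSlope]
  simp only [derivative_mul, derivative_pow, derivative_sub, derivative_X,
    derivative_C, derivative_add, eval_add, eval_mul, eval_sub, eval_X, eval_C, eval_pow]
  simp
  ring

/-! ### Existence, uniqueness and coefficients of the optimal operator. -/

namespace DDO

variable {l r : ℕ}

/-- The polynomial vanishes at every node, so all cell differences drop out, and its slopes select
the single coefficient at `j`. -/
theorem functional_hermiteSlope (D : DDO l r l r) {j : ℤ}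
    (hj : j ∈ Finset.Icc (-(l : ℤ)) (r : ℤ)) :
    (D.functional fun s => (hermiteSlope l r j).derivative.eval s) = D.β j := by
  have h0 : ∀ i ∈ Finset.Icc (-(l : ℤ)) (r : ℤ), (hermiteSlope l r j).eval (i : ℝ) = 0 := by
    intro i hi
    rw [hermiteSlope, eval_mul, eval_pow, eval_stencilBasis hi]
    split_ifs with h
    · simp [h]
    · simp
  rw [functional_eval_derivative, Finset.sum_eq_zero, zero_add, Finset.sum_eq_single j]
  · rw [derivative_hermiteSlope]
    simp [eval_stencilBasis hj]
  · intro i hi hij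
    rw [derivative_hermiteSlope]
    simp [eval_stencilBasis hi, hij]
  · exact fun h => absurd hj h
  · intro k hk
    rw [Finset.mem_Ico] at hk
    have h1 := h0 (k + 1) (Finset.mem_Icc.2 (by omega))
    push_cast at h1
    rw [h1, h0 k (Finset.mem_Icc.2 (by omega))]
    ring

theorem functional_derivative_eq_of_moment {D : DDO l r l r} {p : ℕ} (hp : 1 ≤ p)
    (h : ∀ d ≤ p, D.moment d = if d = 1 then 1 else 0) {U : ℝ[X]} (hU : U.natDegree ≤ p + 1) :
    (D.functional fun s => U.derivative.eval s) = U.derivative.coeff 1 := by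
  have h1 : U.derivative.natDegree < p + 1 := by
    have := natDegree_derivative_le U
    omega
  rw [functional_eval D h1, Finset.sum_eq_single 1]
  · rw [h 1 hp, if_pos rfl, mul_one]
  · intro d hd hd1
    rw [h d (by simpa [Nat.lt_succ_iff] using hd), if_neg hd1, mul_zero]
  · intro h
    simp at h
    omega

/-- The moments up to the optimal order determine the operator. -/
theorem eq_zero_of_moment (D : DDO l r l r) (h : ∀ d ≤ l + r + l + r, D.moment d = 0) :
    D.α = 0 ∧ D.β = 0 := by
  have hz : ∀ U : ℝ[X], U.natDegree ≤ l + r + l + r + 1 →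
      (D.functional fun s => U.derivative.eval s) = 0 := by
    intro U hU
    have h1 : U.derivative.natDegree < l + r + l + r + 1 := by
      have := natDegree_derivative_le U
      omega
    rw [functional_eval D h1]
    exact Finset.sum_eq_zero fun d hd => by
      rw [h d (by simpa [Nat.lt_succ_iff] using hd), mul_zero]
  have hβ : D.β = 0 := by
    funext j
    by_cases hj : j ∈ Finset.Icc (-(l : ℤ)) (r : ℤ)
    · rw [← functional_hermiteSlope D hj, hz _ (natDegree_hermiteSlope_le hj)]
      rfl
    · exact D.β_eq_zero j hj
  refine ⟨?_, hβ⟩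
  funext k
  by_cases hk : k ∈ Finset.Ico (-(l : ℤ)) (r : ℤ)
  -- With `β = 0` only cell differences remain. Interpolating a step that jumps between `k` and `k +
  -- 1` makes the difference over the cell `k` the only nonzero one.
  · set U : ℝ[X] := Lagrange.interpolate (Finset.Icc (-(l : ℤ)) (r : ℤ)) (fun i => (i : ℝ))
      (fun i => if k < i then 1 else 0) with hU
    have hev : ∀ i ∈ Finset.Icc (-(l : ℤ)) (r : ℤ), U.eval (i : ℝ) = if k < i then 1 else 0 :=
      fun i hi => Lagrange.eval_interpolate_at_node (v := fun i : ℤ => (i : ℝ)) _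
        (intCast_injOn _) hi
    have hdeg : U.natDegree ≤ l + r + l + r + 1 := by
      have h1 := Lagrange.degree_interpolate_lt (v := fun i : ℤ => (i : ℝ))
        (fun i => if k < i then (1 : ℝ) else 0) (intCast_injOn (Finset.Icc (-(l : ℤ)) (r : ℤ)))
      rw [← hU, card_stencil] at h1
      have := natDegree_le_of_degree_le h1.le
      omega
    have h1 := hz U hdeg
    rw [functional_eval_derivative, hβ] at h1
    simp only [Pi.zero_apply, zero_mul, Finset.sum_const_zero, add_zero] at h1
    rw [Finset.sum_eq_single k] at h1
    · have hk' := Finset.mem_Ico.1 hk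
      have h2 := hev (k + 1) (Finset.mem_Icc.2 (by omega))
      push_cast at h2
      rw [h2, hev k (Finset.mem_Icc.2 (by omega))] at h1
      simpa using h1
    · intro i hi hik
      have hi' := Finset.mem_Ico.1 hi
      have h2 := hev (i + 1) (Finset.mem_Icc.2 (by omega))
      push_cast at h2
      rw [h2, hev i (Finset.mem_Icc.2 (by omega))]
      have : k < i + 1 ↔ k < i := by omega
      simp [this]
    · exact fun h => absurd hk h
  · exact D.α_eq_zero k hk

/-- The square of the nodal polynomial `w` has zero Hermite data, so the functional kills `(w ^
2)'`. If one more moment vanished, the value would be `(w ^ 2)''(0) = 2 w'(0) ^ 2`, which is nonzero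
because `0` is a simple root of `w`. -/
theorem moment_ne_zero {D : DDO l r l r} (hp : 1 ≤ l + r + l + r)
    (h : ∀ d ≤ l + r + l + r, D.moment d = if d = 1 then 1 else 0) :
    D.moment (l + r + l + r + 1) ≠ 0 := by
  intro h'
  set w : ℝ[X] := Lagrange.nodal (Finset.Icc (-(l : ℤ)) (r : ℤ)) fun i => (i : ℝ) with hw
  have h0 : ∀ i ∈ Finset.Icc (-(l : ℤ)) (r : ℤ), w.eval (i : ℝ) = 0 := fun i hi =>
    Lagrange.eval_nodal_at_node (v := fun i : ℤ => (i : ℝ)) hi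
  have hder : (w ^ 2).derivative = 2 * w * w.derivative := by
    rw [derivative_pow]
    simp only [Nat.cast_ofNat, Nat.add_one_sub_one, pow_one, C_ofNat]
  have h1 : (D.functional fun s => (w ^ 2).derivative.eval s) = 0 := by
    rw [functional_eval_derivative, Finset.sum_eq_zero, Finset.sum_eq_zero, add_zero]
    · intro i hi
      rw [hder]
      simp [h0 i hi]
    · intro k hk
      rw [Finset.mem_Ico] at hk
      have h1 := h0 (k + 1) (Finset.mem_Icc.2 (by omega))
      push_cast at h1
      rw [eval_pow, eval_pow, h1, h0 k (Finset.mem_Icc.2 (by omega))]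
      ring
  have hdeg : (w ^ 2).derivative.natDegree < l + r + l + r + 2 := by
    have h2 := natDegree_derivative_le (w ^ 2)
    have h3 : w.natDegree = l + r + 1 := by rw [hw, Lagrange.natDegree_nodal, card_stencil]
    rw [natDegree_pow, h3] at h2
    omega
  rw [functional_eval D hdeg, Finset.sum_eq_single 1, h 1 hp, if_pos rfl, mul_one] at h1
  · have h2 := coeff_derivative (w ^ 2).derivative 0
    rw [zero_add, Nat.cast_zero, zero_add, mul_one, h1, coeff_zero_eq_eval_zero, hder] at h2
    have h3 := h0 0 (zero_mem_stencil l r)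
    have h4 := Lagrange.eval_nodal_derivative_eval_node_eq (v := fun i : ℤ => (i : ℝ))
      (zero_mem_stencil l r)
    have h5 := eval_stencilNodal_ne_zero (zero_mem_stencil l r)
    rw [stencilNodal, ← h4, ← hw] at h5
    rw [Int.cast_zero] at h3 h5
    simp [h3] at h2
    exact h5 h2
  · intro d hd hd1
    rcases eq_or_ne d (l + r + l + r + 1) with rfl | hd2
    · rw [h', mul_zero]
    · rw [Finset.mem_range] at hd
      rw [h d (by omega), if_neg hd1, mul_zero]
  · intro h
    simp at h

/-- The operator with given coefficients on the stencil. -/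
noncomputable def ofCoeffs (a : Finset.Ico (-(l : ℤ)) (r : ℤ) → ℝ) (b : Finset.Icc (-(l : ℤ)) (r : ℤ) → ℝ) :
    DDO l r l r where
  α k := if h : k ∈ Finset.Ico (-(l : ℤ)) (r : ℤ) then a ⟨k, h⟩ else 0
  β k := if h : k ∈ Finset.Icc (-(l : ℤ)) (r : ℤ) then b ⟨k, h⟩ else 0
  α_eq_zero _ h := dif_neg h
  β_eq_zero _ h := dif_neg h

theorem functional_ofCoeffs (a : Finset.Ico (-(l : ℤ)) (r : ℤ) → ℝ)
    (b : Finset.Icc (-(l : ℤ)) (r : ℤ) → ℝ) (g : ℝ → ℝ) :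
    (ofCoeffs a b).functional g = ∑ k, a k * (∫ s in ((k : ℤ) : ℝ)..((k : ℤ) + 1), g s) +
      ∑ k, b k * g ((k : ℤ) : ℝ) := by
  unfold functional
  rw [← Finset.sum_coe_sort (Finset.Ico _ _), ← Finset.sum_coe_sort (Finset.Icc _ _)]
  congr 1 <;> refine Finset.sum_congr rfl fun k _ => ?_ <;> simp only [ofCoeffs, k.2, dite_true]

/-- The `(l + r) + (l + r + 1)` coefficients are as many as the moments of degree `0` to `2 (l +
r)`, so injectivity of the moment map gives surjectivity. -/
theorem exists_moment_eq (v : ℕ → ℝ) :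
    ∃ D : DDO l r l r, ∀ d ≤ l + r + l + r, D.moment d = v d := by
  let Φ : ((Finset.Ico (-(l : ℤ)) (r : ℤ) → ℝ) × (Finset.Icc (-(l : ℤ)) (r : ℤ) → ℝ)) →ₗ[ℝ]
      (Fin (l + r + l + r + 1) → ℝ) :=
    { toFun := fun x d => (ofCoeffs x.1 x.2).moment d
      map_add' := fun x y => by
        funext d
        simp only [moment, functional_ofCoeffs, Prod.fst_add, Prod.snd_add, Pi.add_apply, add_mul,
          Finset.sum_add_distrib]
        ring
      map_smul' := fun c x => by
        funext d
        simp only [moment, functional_ofCoeffs, Prod.smul_fst, Prod.smul_snd, Pi.smul_apply,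
          smul_eq_mul, RingHom.id_apply, mul_add, Finset.mul_sum, mul_assoc] }
  have hinj : Function.Injective Φ := by
    rw [← LinearMap.ker_eq_bot, LinearMap.ker_eq_bot']
    intro x hx
    have h1 : ∀ d ≤ l + r + l + r, (ofCoeffs x.1 x.2).moment d = 0 := fun d hd =>
      congrFun hx ⟨d, by omega⟩
    obtain ⟨hα, hβ⟩ := eq_zero_of_moment _ h1
    refine Prod.ext (funext fun k => ?_) (funext fun k => ?_)
    · have := congrFun hα k
      simp only [ofCoeffs, k.2, dite_true, Pi.zero_apply] at this
      exact this
    · have := congrFun hβ k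
      simp only [ofCoeffs, k.2, dite_true, Pi.zero_apply] at this
      exact this
  have hsurj := (LinearMap.injective_iff_surjective_of_finrank_eq_finrank (by
    simp only [Module.finrank_prod, Module.finrank_fintype_fun_eq_card, Fintype.card_coe,
      Fintype.card_fin, card_stencil, Int.card_Ico]
    omega)).1 hinj
  obtain ⟨x, hx⟩ := hsurj fun d => v d
  exact ⟨ofCoeffs x.1 x.2, fun d hd => congrFun hx ⟨d, by omega⟩⟩

theorem existsUnique_isOptimal (hp : 1 ≤ l + r + l + r) : ∃! D : DDO l r l r, D.IsOptimal := by
  obtain ⟨D, hD⟩ := exists_moment_eq (l := l) (r := r) fun d => if d = 1 then 1 else 0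
  refine ⟨D, isAccurateOfOrder_of_moment hp hD (moment_ne_zero hp hD), fun E hE => ?_⟩
  let F : DDO l r l r :=
    { α := E.α - D.α
      β := E.β - D.β
      α_eq_zero := fun k hk => by simp [E.α_eq_zero k hk, D.α_eq_zero k hk]
      β_eq_zero := fun k hk => by simp [E.β_eq_zero k hk, D.β_eq_zero k hk] }
  have hF : ∀ d ≤ l + r + l + r, F.moment d = 0 := fun d hd => by
    have h1 : F.moment d = E.moment d - D.moment d := by
      simp only [moment, functional, F, Pi.sub_apply, sub_mul, Finset.sum_sub_distrib]
      ring
    rw [h1, hE.moment_eq hd, hD d hd, sub_self]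
  obtain ⟨hα, hβ⟩ := eq_zero_of_moment F hF
  exact DDO.ext (sub_eq_zero.1 hα) (sub_eq_zero.1 hβ)

theorem IsOptimal.β_eq {D : DDO l r l r} (hD : D.IsOptimal) (hp : 1 ≤ l + r + l + r) {j : ℤ}
    (hj : j ∈ Finset.Icc (-(l : ℤ)) (r : ℤ)) :
    D.β j = (hermiteSlope l r j).derivative.coeff 1 := by
  rw [← functional_hermiteSlope D hj, functional_derivative_eq_of_moment hp
    (fun d hd => IsAccurateOfOrder.moment_eq hD hd) (natDegree_hermiteSlope_le hj)]

/-- As `L_j(0) = 0`, only `-2 j L_j'(0) ^ 2` survives in the second derivative. -/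
theorem IsOptimal.β_eq_of_ne_zero {D : DDO l r l r} (hD : D.IsOptimal) (hp : 1 ≤ l + r + l + r)
    {j : ℤ} (hj : j ∈ (Finset.Icc (-(l : ℤ)) (r : ℤ)).erase 0) :
    D.β j * shiftedChoose l r 0 ^ 2 = -2 * shiftedChoose l r j ^ 2 / j := by
  have h0 := eval_stencilBasis (j := j) (zero_mem_stencil l r)
  rw [if_neg (Finset.ne_of_mem_erase hj).symm, Int.cast_zero] at h0
  have hj0' : (j : ℝ) ≠ 0 := by exact_mod_cast Finset.ne_of_mem_erase hj
  have h6 := (shiftedChoose_pos (zero_mem_stencil l r)).ne'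
  have hsq : ((-1 : ℝ) ^ j) ^ 2 = 1 := by
    rw [← zpow_natCast, ← zpow_mul, mul_comm, zpow_mul]; norm_num
  rw [hD.β_eq hp (Finset.mem_of_mem_erase hj), coeff_one_derivative_hermiteSlope, h0,
    eval_zero_derivative_stencilBasis hj]
  field_simp
  rw [hsq]
  ring

/-- Here the second derivative is `4 L_0'(0)`, and differentiating `∑ L_j = 1` expresses `L_0'(0)`
through the other basis polynomials. -/
theorem IsOptimal.β_zero_eq {D : DDO l r l r} (hD : D.IsOptimal) (hp : 1 ≤ l + r + l + r) :
    D.β 0 * shiftedChoose l r 0 ^ 2 = ∑ j ∈ (Finset.Icc (-(l : ℤ)) (r : ℤ)).erase 0,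
      4 * (-1) ^ j * shiftedChoose l r 0 * shiftedChoose l r j / j := by
  have h0 := eval_stencilBasis (j := 0) (zero_mem_stencil l r)
  rw [if_pos rfl, Int.cast_zero] at h0
  have h6 := (shiftedChoose_pos (zero_mem_stencil l r)).ne'
  have hsum := Lagrange.sum_basis (v := fun i : ℤ => (i : ℝ))
    (intCast_injOn (Finset.Icc (-(l : ℤ)) (r : ℤ))) ⟨0, zero_mem_stencil l r⟩
  have h1 := congrArg (fun P : ℝ[X] => P.derivative.eval 0) hsum
  simp only [derivative_sum, eval_finsetSum, derivative_one, eval_zero] at h1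
  rw [← Finset.add_sum_erase _ _ (zero_mem_stencil l r)] at h1
  change (stencilBasis l r 0).derivative.eval 0 +
    ∑ j ∈ (Finset.Icc (-(l : ℤ)) (r : ℤ)).erase 0, (stencilBasis l r j).derivative.eval 0 = 0 at h1
  rw [Finset.sum_congr rfl fun j hj => eval_zero_derivative_stencilBasis hj,
    Finset.sum_neg_distrib, add_neg_eq_zero] at h1
  rw [hD.β_eq hp (zero_mem_stencil l r), coeff_one_derivative_hermiteSlope, h0, h1, Int.cast_zero,
    mul_zero, zero_mul, sub_zero, mul_one, Finset.mul_sum, Finset.sum_mul]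
  refine Finset.sum_congr rfl fun j hj => ?_
  have hj0' : (j : ℝ) ≠ 0 := by exact_mod_cast Finset.ne_of_mem_erase hj
  field_simp

theorem H_pi_re (D : DDO l r l r) :
    (D.H Real.pi).re = ∑ j ∈ Finset.Icc (-(l : ℤ)) (r : ℤ), (-1) ^ j * D.β j := by
  rw [H, Complex.re_sum]
  refine Finset.sum_congr rfl fun j _ => ?_
  have : Complex.exp (Complex.I * j * Real.pi) = (((-1) ^ j : ℝ) : ℂ) := by
    rw [show Complex.I * j * Real.pi = j * (Real.pi * Complex.I) by ring, Complex.exp_int_mul,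
      Complex.exp_pi_mul_I]
    push_cast
    rfl
  rw [this, ← Complex.ofReal_mul, Complex.ofReal_re, mul_comm]

theorem IsOptimal.H_pi_re_mul {D : DDO l r l r} (hD : D.IsOptimal) (hp : 1 ≤ l + r + l + r) :
    (D.H Real.pi).re * shiftedChoose l r 0 ^ 2 =
      2 * ∑ j ∈ (Finset.Icc (-(l : ℤ)) (r : ℤ)).erase 0, (-1) ^ j *
        (2 * shiftedChoose l r 0 * shiftedChoose l r j - shiftedChoose l r j ^ 2) / j := by
  rw [H_pi_re, ← Finset.add_sum_erase _ _ (zero_mem_stencil l r), add_mul, zpow_zero, one_mul,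
    hD.β_zero_eq hp, Finset.sum_mul, Finset.mul_sum, ← Finset.sum_add_distrib]
  refine Finset.sum_congr rfl fun j hj => ?_
  rw [mul_assoc ((-1 : ℝ) ^ j), hD.β_eq_of_ne_zero hp hj]
  ring

theorem IsOptimal.exists_H_pi_re_eq {t m : ℕ} (hm : Odd m) {D : DDO (t + m) t (t + m) t}
    (hD : D.IsOptimal) : ∃ c : ℝ, 0 < c ∧ (D.H Real.pi).re =
      c * ∫ x in (0 : ℝ)..Real.pi, ∫ y in (0 : ℝ)..(Real.pi - x),
        (2 * Real.sin (x / 2)) ^ (t + m + t) * (2 * Real.sin (y / 2)) ^ (t + m + t) *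
          Real.sin (m * (x + y) / 2) := by
  have hm1 := hm.pos
  have h1 := hD.H_pi_re_mul (by omega)
  have h2 := shiftedChoose_pos (zero_mem_stencil (t + m) t)
  have h3 := Real.pi_pos
  rw [sum_shiftedChoose_eq_integral t m hm] at h1
  refine ⟨2 / (Real.pi * shiftedChoose (t + m) t 0 ^ 2), by positivity, ?_⟩
  rw [eq_div_of_mul_eq (pow_ne_zero 2 h2.ne') h1]
  field_simp

end DDO

/-! ### The sign of the symbol at π. -/

/-- The sign of the triangle integral when `sin (m π / 2) = ε = ±1`. -/
theorem eventually_sign_integral (m : ℕ) {ε : ℝ} (hε : |ε| = 1)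
    (h : ε * Real.sin (m * Real.pi / 2) = 1) :
    ∀ᶠ t : ℕ in atTop, 0 < ε * ∫ x in (0 : ℝ)..Real.pi, ∫ y in (0 : ℝ)..(Real.pi - x),
      (2 * Real.sin (x / 2)) ^ (t + m + t) * (2 * Real.sin (y / 2)) ^ (t + m + t) *
        Real.sin (m * (x + y) / 2) := by
  have h1 := eventually_integral_triangle_pos (g := fun z => ε * Real.sin (m * z / 2))
    (by fun_prop) (fun z => by rw [abs_mul, hε, one_mul]; exact Real.abs_sin_le_one _) h
  have h2 : Tendsto (fun t : ℕ => t + m + t) atTop atTop :=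
    tendsto_atTop_mono (fun t => show t ≤ t + m + t by omega) tendsto_id
  filter_upwards [h2.eventually h1] with t ht
  simp_rw [mul_left_comm _ ε, intervalIntegral.integral_const_mul] at ht
  exact ht

theorem theorem3 (m : ℕ) :
    (m ≡ 1 [MOD 4] → ∀ᶠ t : ℕ in atTop,
      (∃! D : DDO (t + m) t (t + m) t, D.IsOptimal) ∧
        ∀ D : DDO (t + m) t (t + m) t, D.IsOptimal → 0 < (D.H Real.pi).re) ∧
    (m ≡ 3 [MOD 4] → ∀ᶠ t : ℕ in atTop,
      (∃! D : DDO (t + m) t (t + m) t, D.IsOptimal) ∧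
        ∀ D : DDO (t + m) t (t + m) t, D.IsOptimal → (D.H Real.pi).re < 0) := by
  constructor <;> intro hm <;> unfold Nat.ModEq at hm
  · obtain ⟨k, rfl⟩ : ∃ k, m = 4 * k + 1 := ⟨m / 4, by omega⟩
    have hs := eventually_sign_integral (4 * k + 1) (ε := 1) (by simp) (by
      rw [show ((4 * k + 1 : ℕ) : ℝ) * Real.pi / 2 = Real.pi / 2 + k * (2 * Real.pi) by
        push_cast; ring, Real.sin_add_nat_mul_two_pi, Real.sin_pi_div_two, mul_one])
    filter_upwards [hs] with t ht
    refine ⟨DDO.existsUnique_isOptimal (by omega), fun D hD => ?_⟩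
    obtain ⟨c, hc, h⟩ := hD.exists_H_pi_re_eq ⟨2 * k, by ring⟩
    rw [h]
    rw [one_mul] at ht
    exact mul_pos hc ht
  · obtain ⟨k, rfl⟩ : ∃ k, m = 4 * k + 3 := ⟨m / 4, by omega⟩
    have hs := eventually_sign_integral (4 * k + 3) (ε := -1) (by simp) (by
      rw [show ((4 * k + 3 : ℕ) : ℝ) * Real.pi / 2 = Real.pi / 2 + Real.pi + k * (2 * Real.pi) by
        push_cast; ring, Real.sin_add_nat_mul_two_pi, Real.sin_add_pi, Real.sin_pi_div_two]
      norm_num)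
    filter_upwards [hs] with t ht
    refine ⟨DDO.existsUnique_isOptimal (by omega), fun D hD => ?_⟩
    obtain ⟨c, hc, h⟩ := hD.exists_H_pi_re_eq ⟨2 * k + 1, by ring⟩
    rw [h]
    exact mul_neg_of_pos_of_neg hc (by linarith)
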